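/- For integers $r,n\ge 1$ let $$S_r(n)=\sum_{j=0}^{n}\frac{j}{j+r}\binom nj\in\mathbb Q.$$ The upper asymptotic density of a set $A$ of positive integers is $\limsup_{N\to\infty}\frac1N\,\#(A\cap\{1,\dots,N\})$. Then for each real number $k>0$ there exists a constant $c_k>0$ (depending only on $k$) such that, for every integer $r>1$, the upper asymptotic density of $\{n\ge 1: S_r(n)\in\mathbb Z\}$ is at most $c_k/r^k$. -/

import Mathlib

/-- The sum `S_r(n) = ∑_{k=0}^{n} k / (k + r) * (n choose k)`, as a rational number. -/
def binomialSum (r n : ℕ) : ℚ :=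
  ∑ k ∈ Finset.range (n + 1), (k : ℚ) / ((k : ℚ) + (r : ℚ)) * (n.choose k : ℚ)

/-- The upper asymptotic density of a set `A` of natural numbers,
`limsup_{N → ∞} #(A ∩ {1, …, N}) / N`. The quotients lie in `[0, 1]`, so that this
is a genuine upper limit in `ℝ`. -/
noncomputable def upperAsymptoticDensity (A : Set ℕ) : ℝ :=
  Filter.limsup (fun N : ℕ => ((A ∩ Set.Icc 1 N).ncard : ℝ) / (N : ℝ)) Filter.atTop

/-! The density is in fact zero. `binomialSum_eq` writes the sum as an integer minus a combination
of (2^m - 1)/m over the window n+1 ≤ m ≤ n+r. Let p > r be an odd prime modulo which 2 is a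
non-residue. It divides at most one m in the window, and if that m is odd it cannot divide 2^m - 1,
so p survives in the denominator (`binomialSum_not_int`). Integrality thus makes the odd one of n+1,
n+2 coprime to all such p, and a sieve bounds the density by 2∏(1 - 1/p). The product can be made
arbitrarily small since ∑ 1/p diverges over these primes; this follows by comparing the Euler
products of ζ(s) and L(s, χ₈) as s → 1⁺, and needs only an upper bound for L. -/

open Finset in
/-- The sums `∑ choose n k / (k + r + 1)` are iterated forward differences in `n`. -/
theorem sum_choose_div_eq_fwdDiff (r : ℕ) (n : ℕ) :
    ∑ k ∈ range (n + 1), (n.choose k : ℚ) / ((k : ℚ) + (r + 1 : ℕ)) =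
      (fwdDiff 1)^[r] (fun m : ℕ ↦ ((2 : ℚ) ^ (m + 1) - 1) / ((m : ℚ) + 1)) n := by
  induction r generalizing n with
  | zero =>
    have hterm : ∀ k ∈ range (n + 1), (n.choose k : ℚ) / ((k : ℚ) + (0 + 1 : ℕ)) =
        ((n + 1).choose (k + 1) : ℚ) / ((n : ℚ) + 1) := by
      intro k _
      have h : ((n : ℚ) + 1) * n.choose k = (n + 1).choose (k + 1) * ((k : ℚ) + 1) := by
        exact_mod_cast Nat.add_one_mul_choose_eq n k
      have h1 : (n : ℚ) + 1 ≠ 0 := by positivity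
      have h2 : (k : ℚ) + 1 ≠ 0 := by positivity
      rw [zero_add, Nat.cast_one, div_eq_div_iff h2 h1]
      linarith
    rw [sum_congr rfl hterm, ← sum_div, Function.iterate_zero, id]
    congr 1
    have h := Nat.sum_range_choose (n + 1)
    rw [sum_range_succ'] at h
    simp only [Nat.choose_zero_right] at h
    have h' : (∑ k ∈ range (n + 1), ((n + 1).choose (k + 1) : ℚ)) + 1 = 2 ^ (n + 1) := by
      exact_mod_cast h
    linarith
  | succ r ih =>
    -- By Pascal's rule, differencing in `n` shifts the denominator by one.
    rw [Function.iterate_succ_apply', fwdDiff, ← ih, ← ih, eq_sub_iff_add_eq]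
    rw [sum_range_succ' _ (n + 1)]
    simp only [Nat.choose_succ_succ, Nat.cast_add, add_div, sum_add_distrib]
    rw [sum_range_succ (fun k : ℕ ↦ (n.choose (k + 1) : ℚ) / _) n,
      sum_range_succ' (fun k : ℕ ↦ (n.choose k : ℚ) / ((k : ℚ) + ((r : ℚ) + _))) n]
    simp only [Nat.choose_succ_self, Nat.choose_zero_right]
    have : ∀ k : ℕ, (n.choose k : ℚ) / ((k : ℚ) + ((r : ℚ) + ((1 : ℕ) : ℚ) + ((1 : ℕ) : ℚ))) =
        (n.choose k : ℚ) / ((k : ℚ) + ((1 : ℕ) : ℚ) + ((r : ℚ) + ((1 : ℕ) : ℚ))) := by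
      intro k; congr 1; ring
    simp only [this]
    push_cast
    ring

-- Uses k/(k+r+1) = 1 - (r+1)/(k+r+1).
open Finset in
theorem binomialSum_eq (r n : ℕ) :
    binomialSum (r + 1) n = 2 ^ n - ((r + 1 : ℕ) : ℚ) *
      ∑ j ∈ range (r + 1), ((-1 : ℚ) ^ (r - j) * r.choose j) *
        (((2 : ℚ) ^ (n + j + 1) - 1) / ((n + j + 1 : ℕ) : ℚ)) := by
  have h := sum_choose_div_eq_fwdDiff r n
  rw [fwdDiff_iter_eq_sum_shift] at h
  have h2 : ∀ j ∈ range (r + 1), ((-1 : ℚ) ^ (r - j) * r.choose j) *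
        (((2 : ℚ) ^ (n + j + 1) - 1) / ((n + j + 1 : ℕ) : ℚ)) =
      ((-1 : ℤ) ^ (r - j) * r.choose j) •
        (((2 : ℚ) ^ (n + j • 1 + 1) - 1) / (((n + j • 1 : ℕ) : ℚ) + 1)) := by
    intro j _
    simp [zsmul_eq_mul]
  rw [sum_congr rfl h2, ← h, binomialSum, eq_sub_iff_add_eq, mul_sum, ← sum_add_distrib]
  have h3 : (∑ k ∈ range (n + 1), (n.choose k : ℚ)) = 2 ^ n := by
    exact_mod_cast Nat.sum_range_choose n
  rw [← h3]
  refine sum_congr rfl fun k _ ↦ ?_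
  have : (k : ℚ) + ((r + 1 : ℕ) : ℚ) ≠ 0 := by positivity
  field_simp

/-! ### The p-adic obstruction -/

/-- If 2^(2t+1) = 1 mod p, then 2 = (2^(t+1))² is a square. -/
theorem not_dvd_two_pow_sub_one_of_odd {p m : ℕ} [Fact p.Prime] (hp : p ≠ 2)
    (hχ : ZMod.χ₈ p ≠ 1) (hm : Odd m) : ¬ (p : ℤ) ∣ 2 ^ m - 1 := by
  intro hdvd
  have h2 : (2 : ZMod p) ^ m = 1 := by
    have := (ZMod.intCast_zmod_eq_zero_iff_dvd _ p).2 hdvd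
    push_cast at this
    exact sub_eq_zero.1 this
  obtain ⟨t, rfl⟩ := hm
  have hsq : IsSquare (2 : ZMod p) := by
    refine ⟨2 ^ (t + 1), ?_⟩
    calc (2 : ZMod p) = 2 * 2 ^ (2 * t + 1) := by rw [h2, mul_one]
      _ = 2 ^ (t + 1) * 2 ^ (t + 1) := by ring
  have h8 := (ZMod.exists_sq_eq_two_iff hp).1 hsq
  rw [ZMod.χ₈_nat_eq_if_mod_eight, if_neg (by omega), if_pos h8] at hχ
  exact hχ rfl

open Finset in
/-- An odd prime `p > r + 1` for which `2` is not a quadratic residue, dividing an odd number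
among `n + 1, …, n + r + 1`, prevents `binomialSum (r + 1) n` from being an integer. -/
theorem binomialSum_not_int {r n i p : ℕ} (hp : p.Prime) (hrp : r + 1 < p) (hp2 : p ≠ 2)
    (hχ : ZMod.χ₈ p ≠ 1) (hi : i ≤ r) (hodd : Odd (n + i + 1)) (hdvd : p ∣ n + i + 1)
    (m : ℤ) : binomialSum (r + 1) n ≠ m := by
  have := Fact.mk hp
  intro hm
  rw [binomialSum_eq, ← add_sum_erase _ _ (mem_range.2 (Nat.lt_succ_of_le hi)), mul_add] at hm
  set T := ∑ j ∈ (range (r + 1)).erase i, ((-1 : ℚ) ^ (r - j) * r.choose j) *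
        (((2 : ℚ) ^ (n + j + 1) - 1) / ((n + j + 1 : ℕ) : ℚ)) with hT
  have hTle : padicNorm p T ≤ 1 := by
    refine padicNorm.sum_le' (fun j hj ↦ ?_) zero_le_one
    obtain ⟨hji, hj⟩ := mem_erase.1 hj
    have hj := mem_range.1 hj
    -- Two multiples of p cannot differ by at most r < p.
    have hnd : ¬ p ∣ n + j + 1 := by
      intro hd
      rcases lt_or_gt_of_ne hji with h | h
      · have := Nat.le_of_dvd (by omega) (Nat.dvd_sub hdvd hd)
        omega
      · have := Nat.le_of_dvd (by omega) (Nat.dvd_sub hd hdvd)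
        omega
    rw [← mul_div_assoc, padicNorm.div, (padicNorm.nat_eq_one_iff _).2 hnd, div_one]
    exact_mod_cast padicNorm.of_int
      (((-1 : ℤ) ^ (r - j) * r.choose j) * ((2 : ℤ) ^ (n + j + 1) - 1))
  have hmain : (((r + 1 : ℕ) : ℤ) * (((-1 : ℤ) ^ (r - i) * r.choose i) *
      ((2 : ℤ) ^ (n + i + 1) - 1)) : ℤ) / ((n + i + 1 : ℕ) : ℚ) =
      ((2 ^ n - m : ℤ) : ℚ) - ((r + 1 : ℕ) : ℚ) * T := by
    push_cast at hm ⊢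
    rw [← hm]
    ring
  have hrhs : padicNorm p (((2 ^ n - m : ℤ) : ℚ) - ((r + 1 : ℕ) : ℚ) * T) ≤ 1 := by
    refine padicNorm.sub.trans (max_le (padicNorm.of_int _) ?_)
    rw [padicNorm.mul]
    exact mul_le_one₀ (padicNorm.of_nat _) (padicNorm.nonneg _) hTle
  have hnum : ¬ (p : ℤ) ∣ ((r + 1 : ℕ) : ℤ) * (((-1 : ℤ) ^ (r - i) * r.choose i) *
      ((2 : ℤ) ^ (n + i + 1) - 1)) := by
    have hpZ : Prime (p : ℤ) := Nat.prime_iff_prime_int.1 hp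
    intro h
    rcases hpZ.dvd_or_dvd h with h | h
    · have := Nat.le_of_dvd (Nat.succ_pos r) (Int.natCast_dvd_natCast.1 h)
      omega
    rcases hpZ.dvd_or_dvd h with h | h
    · rcases hpZ.dvd_or_dvd h with h | h
      · exact hpZ.not_dvd_one (hpZ.dvd_of_dvd_pow h |>.trans (by norm_num))
      · have h' : p ∣ r.factorial := by
          rw [← Nat.choose_mul_factorial_mul_factorial hi, mul_assoc]
          exact (Int.natCast_dvd_natCast.1 h).mul_right _
        have := (hp.dvd_factorial).1 h'
        omega
    · exact not_dvd_two_pow_sub_one_of_odd hp2 hχ hodd h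
  rw [← hmain, padicNorm.div, (padicNorm.int_eq_one_iff _).2 hnum] at hrhs
  have hlt : padicNorm p ((n + i + 1 : ℕ) : ℚ) < 1 := (padicNorm.nat_lt_one_iff _).2 hdvd
  have hpos : 0 < padicNorm p ((n + i + 1 : ℕ) : ℚ) :=
    lt_of_le_of_ne (padicNorm.nonneg _)
      (padicNorm.nonzero (Nat.cast_ne_zero.2 (Nat.succ_ne_zero _))).symm
  exact absurd hrhs (not_le.2 ((one_lt_div hpos).2 hlt))

/-! ### Divergence of ∑ 1/p over χ₈(p) ≠ 1 -/

/-- The completely multiplicative function `n ↦ n ^ (-s)`. -/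
noncomputable def rpowNegHom (s : ℝ) (hs : s ≠ 0) : ℕ →*₀ ℝ where
  toFun n := (n : ℝ) ^ (-s)
  map_zero' := by simp [Real.zero_rpow (neg_ne_zero.2 hs)]
  map_one' := by simp
  map_mul' m n := by push_cast; exact Real.mul_rpow (Nat.cast_nonneg m) (Nat.cast_nonneg n)

/-- The completely multiplicative function `n ↦ χ₈ n * n ^ (-s)`. -/
noncomputable def chiEightRpowNegHom (s : ℝ) (hs : s ≠ 0) : ℕ →*₀ ℝ where
  toFun n := (ZMod.χ₈ n : ℝ) * (n : ℝ) ^ (-s)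
  map_zero' := by simp [Real.zero_rpow (neg_ne_zero.2 hs)]
  map_one' := by simp
  map_mul' m n := by
    push_cast
    rw [Real.mul_rpow (Nat.cast_nonneg m) (Nat.cast_nonneg n), map_mul]
    push_cast
    ring

theorem summable_norm_rpowNegHom {s : ℝ} (hs : 1 < s) :
    Summable (‖rpowNegHom s (by positivity) ·‖) := by
  refine (Real.summable_nat_rpow.2 (by linarith : -s < -1)).congr fun n ↦ ?_
  exact (Real.norm_of_nonneg (Real.rpow_nonneg (Nat.cast_nonneg n) _)).symm

theorem chiEight_nat_cases (n : ℕ) :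
    ZMod.χ₈ n = 0 ∨ ZMod.χ₈ n = 1 ∨ ZMod.χ₈ n = -1 := ZMod.isQuadratic_χ₈ n

theorem summable_norm_chiEightRpowNegHom {s : ℝ} (hs : 1 < s) :
    Summable (‖chiEightRpowNegHom s (by positivity) ·‖) := by
  refine (summable_norm_rpowNegHom hs).of_nonneg_of_le (fun _ ↦ norm_nonneg _) fun n ↦ ?_
  change ‖(ZMod.χ₈ n : ℝ) * (n : ℝ) ^ (-s)‖ ≤ ‖(n : ℝ) ^ (-s)‖
  rw [norm_mul]
  refine mul_le_of_le_one_left (norm_nonneg _) ?_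
  rcases chiEight_nat_cases n with h | h | h <;> simp [h]

/-- After the term 1, each block of eight has signs -, -, +, + at residues 3, 5, 7, 9; pairing 3
with 7 and 5 with 9 makes it nonpositive. -/
theorem sum_chiEight_rpow_le_one {s : ℝ} (hs : 0 < s) (M : ℕ) :
    ∑ n ∈ Finset.range (8 * M + 2), (ZMod.χ₈ n : ℝ) * (n : ℝ) ^ (-s) ≤ 1 := by
  induction M with
  | zero => simp [Finset.sum_range_succ]
  | succ M ih =>
    have hmono : ∀ a b : ℕ, 0 < a → a ≤ b → (b : ℝ) ^ (-s) ≤ (a : ℝ) ^ (-s) := fun a b ha hab ↦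
      Real.rpow_le_rpow_of_nonpos (Nat.cast_pos.2 ha) (Nat.cast_le.2 hab) (by linarith)
    have hval : ∀ j : ℕ, ZMod.χ₈ ((8 * M + j : ℕ) : ZMod 8) = ZMod.χ₈ (j : ZMod 8) := by
      intro j
      rw [ZMod.χ₈_nat_mod_eight, Nat.mul_add_mod, ← ZMod.χ₈_nat_mod_eight]
    rw [show 8 * (M + 1) + 2 = 8 * M + 2 + 1 + 1 + 1 + 1 + 1 + 1 + 1 + 1 by ring]
    iterate 8 rw [Finset.sum_range_succ]
    have e : ∀ j, ZMod.χ₈ ((8 * M + j : ℕ) : ZMod 8) =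
        if j % 2 = 0 then 0 else if j % 8 = 1 ∨ j % 8 = 7 then 1 else -1 := fun j ↦ by
      rw [hval, ZMod.χ₈_nat_eq_if_mod_eight]
    generalize ∑ n ∈ Finset.range (8 * M + 2), (ZMod.χ₈ n : ℝ) * (n : ℝ) ^ (-s) = S at ih ⊢
    simp only [add_assoc, e]
    norm_num
    have h1 := hmono (8 * M + 3) (8 * M + 7) (by omega) (by omega)
    have h2 := hmono (8 * M + 5) (8 * M + 9) (by omega) (by omega)
    push_cast at h1 h2
    linarith

theorem tsum_chiEightRpowNegHom_le_one {s : ℝ} (hs : 1 < s) :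
    ∑' n, chiEightRpowNegHom s (by positivity) n ≤ 1 := by
  have h := (summable_norm_chiEightRpowNegHom hs).of_norm.hasSum.tendsto_sum_nat
  have hsub : Filter.Tendsto (fun M : ℕ ↦ 8 * M + 2) Filter.atTop Filter.atTop :=
    Filter.tendsto_atTop_mono (fun M ↦ by rw [id]; omega) Filter.tendsto_id
  exact le_of_tendsto' (h.comp hsub) fun M ↦ sum_chiEight_rpow_le_one (by linarith) M

/-- The factors agree when χ₈(p) = 1. Otherwise, with x = p^(-s), 1 - χ₈(p)x ≤ (1 + 3x)(1 - x); for
χ₈(p) = -1 this needs x ≤ 1/3, hence p ≥ 3. -/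
theorem eulerFactor_le {p : ℕ} (hp : p.Prime) {s : ℝ} (hs : 1 < s) :
    (1 - rpowNegHom s (by positivity) p)⁻¹ ≤
      Real.exp (3 * if p.Prime ∧ ZMod.χ₈ p ≠ 1 then 1 / (p : ℝ) else 0) *
        (1 - chiEightRpowNegHom s (by positivity) p)⁻¹ := by
  change (1 - (p : ℝ) ^ (-s))⁻¹ ≤ _ * (1 - (ZMod.χ₈ p : ℝ) * (p : ℝ) ^ (-s))⁻¹
  have hp0 : (0 : ℝ) < p := Nat.cast_pos.2 hp.pos
  have hp2 : (2 : ℝ) ≤ p := by exact_mod_cast hp.two_le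
  set x := (p : ℝ) ^ (-s) with hx
  have hx0 : 0 < x := Real.rpow_pos_of_pos hp0 _
  have hxp : x ≤ 1 / p := by
    rw [one_div, ← Real.rpow_neg_one]
    exact Real.rpow_le_rpow_of_exponent_le (by linarith) (by linarith)
  have hx2 : x ≤ 1 / 2 := hxp.trans (one_div_le_one_div_of_le two_pos hp2)
  have hexp : 1 + 3 * x ≤ Real.exp (3 * (1 / p)) := by
    have := Real.add_one_le_exp (3 * (1 / (p : ℝ)))
    linarith
  have key : ∀ y : ℝ, 0 < y → y ≤ (1 + 3 * x) * (1 - x) →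
      (1 - x)⁻¹ ≤ Real.exp (3 * (1 / p)) * y⁻¹ := by
    intro y hy h
    refine le_trans ?_ (mul_le_mul_of_nonneg_right hexp (inv_nonneg.2 hy.le))
    rw [← div_eq_mul_inv, inv_eq_one_div, div_le_div_iff₀ (by linarith) hy]
    linarith
  rcases chiEight_nat_cases p with h | h | h
  · rw [if_pos ⟨hp, by rw [h]; decide⟩, h]
    refine key _ (by simp) ?_
    push_cast
    nlinarith
  · simp [h]
  · have hp3 : (3 : ℝ) ≤ p := by
      have h3 : p ≠ 2 := by rintro rfl; revert h; decide
      have := hp.two_le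
      exact_mod_cast (by omega : 3 ≤ p)
    have hx3 : x ≤ 1 / 3 := hxp.trans (one_div_le_one_div_of_le three_pos hp3)
    rw [if_pos ⟨hp, by rw [h]; decide⟩, h]
    push_cast
    refine key _ (by linarith) ?_
    nlinarith

/-- The reciprocals of the primes `p` for which `χ₈ p ≠ 1` have a divergent sum. -/
theorem not_summable_one_div_prime_chiEight_ne_one :
    ¬ Summable fun p : ℕ ↦ if p.Prime ∧ ZMod.χ₈ p ≠ 1 then 1 / (p : ℝ) else 0 := by
  intro hsum
  set e : ℕ → ℝ := fun p ↦ if p.Prime ∧ ZMod.χ₈ p ≠ 1 then 1 / (p : ℝ) else 0 with he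
  have he0 : ∀ p, 0 ≤ e p := fun p ↦ by simp only [he]; split_ifs <;> positivity
  set B := Real.exp (3 * ∑' p, e p) with hB
  -- The bound is uniform in s, so s → 1⁺ bounds the harmonic sums.
  have hzeta : ∀ s : ℝ, ∀ hs : 1 < s, ∑' n, rpowNegHom s (by positivity) n ≤ B := by
    intro s hs
    have h1 := EulerProduct.eulerProduct_completely_multiplicative (summable_norm_rpowNegHom hs)
    have h2 := EulerProduct.eulerProduct_completely_multiplicative
      (summable_norm_chiEightRpowNegHom hs)
    have hpos : ∀ p : ℕ, p.Prime → 0 < (1 - rpowNegHom s (by positivity) p)⁻¹ := by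
      intro p hp
      have : (p : ℝ) ^ (-s) < 1 :=
        Real.rpow_lt_one_of_one_lt_of_neg (by exact_mod_cast hp.one_lt) (by linarith)
      exact inv_pos.2 (sub_pos.2 this)
    have hle : ∑' n, rpowNegHom s (by positivity) n ≤
        B * ∑' n, chiEightRpowNegHom s (by positivity) n := by
      refine le_of_tendsto_of_tendsto' h1 (h2.const_mul B) fun N ↦ ?_
      have hfac := Finset.prod_le_prod
        (fun p hp ↦ (hpos p (Nat.prime_of_mem_primesBelow hp)).le)
        (fun p hp ↦ eulerFactor_le (Nat.prime_of_mem_primesBelow hp) hs) (s := N.primesBelow)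
      refine hfac.trans ?_
      rw [Finset.prod_mul_distrib, ← Real.exp_sum, ← Finset.mul_sum]
      refine mul_le_mul_of_nonneg_right (Real.exp_le_exp.2
        (mul_le_mul_of_nonneg_left (hsum.sum_le_tsum _ fun p _ ↦ he0 p) (by norm_num))) ?_
      refine Finset.prod_nonneg fun p hp ↦ ?_
      exact (pos_of_mul_pos_right ((hpos p (Nat.prime_of_mem_primesBelow hp)).trans_le
        (eulerFactor_le (Nat.prime_of_mem_primesBelow hp) hs)) (Real.exp_pos _).le).le
    exact hle.trans (mul_le_of_le_one_right (Real.exp_pos _).le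
      (tsum_chiEightRpowNegHom_le_one hs))
  refine Real.not_summable_one_div_natCast
    (summable_of_sum_range_le (c := B) (fun n ↦ by positivity) fun N ↦ ?_)
  have hcont : Filter.Tendsto (fun s : ℝ ↦ ∑ n ∈ Finset.range N, (n : ℝ) ^ (-s))
      (nhdsWithin 1 (Set.Ioi 1)) (nhds (∑ n ∈ Finset.range N, 1 / (n : ℝ))) := by
    refine tendsto_finsetSum _ fun n _ ↦ ?_
    rcases Nat.eq_zero_or_pos n with rfl | hn
    · refine tendsto_const_nhds.congr' ?_
      filter_upwards [self_mem_nhdsWithin] with s hs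
      have : -s ≠ 0 := neg_ne_zero.2 (by have := Set.mem_Ioi.1 hs; positivity)
      simp [Real.zero_rpow this]
    · have hn0 : (n : ℝ) ≠ 0 := Nat.cast_ne_zero.2 hn.ne'
      have : ContinuousAt (fun s : ℝ ↦ (n : ℝ) ^ (-s)) 1 :=
        (Real.continuousAt_const_rpow hn0).comp continuousAt_neg
      have h := this.tendsto
      rw [Real.rpow_neg_one, ← one_div] at h
      exact h.mono_left nhdsWithin_le_nhds
  refine le_of_tendsto hcont ?_
  filter_upwards [self_mem_nhdsWithin] with s hs
  have hs' : 1 < s := hs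
  exact ((summable_norm_rpowNegHom hs').of_norm.sum_le_tsum _
    fun n _ ↦ Real.rpow_nonneg (Nat.cast_nonneg n) _).trans (hzeta s hs')

/-- Products of `1 - 1 / p` over finite sets of large primes with `χ₈ p ≠ 1` are arbitrarily
small. -/
theorem exists_prod_one_sub_inv_lt (r : ℕ) {ε : ℝ} (hε : 0 < ε) :
    ∃ P : Finset ℕ, (∀ p ∈ P, p.Prime ∧ r < p ∧ ZMod.χ₈ p ≠ 1) ∧
      ∏ p ∈ P, (1 - (p : ℝ)⁻¹) < ε := by
  set e : ℕ → ℝ := fun p ↦ if p.Prime ∧ ZMod.χ₈ p ≠ 1 then 1 / (p : ℝ) else 0 with he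
  have he0 : ∀ p, 0 ≤ e p := fun p ↦ by simp only [he]; split_ifs <;> positivity
  have htend := (not_summable_iff_tendsto_nat_atTop_of_nonneg he0).1
    not_summable_one_div_prime_chiEight_ne_one
  -- The sum of `e` over [r+1, N) then exceeds -log ε.
  obtain ⟨N, hN, hrN⟩ := ((htend.eventually_gt_atTop
    (∑ p ∈ Finset.range (r + 1), e p - Real.log ε)).and
      (Filter.eventually_ge_atTop (r + 1))).exists
  refine ⟨(Finset.Ico (r + 1) N).filter fun p : ℕ ↦ p.Prime ∧ ZMod.χ₈ p ≠ 1, ?_, ?_⟩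
  · intro p hp
    obtain ⟨h1, h2, h3⟩ := Finset.mem_filter.1 hp
    exact ⟨h2, (Finset.mem_Ico.1 h1).1, h3⟩
  · rw [← Finset.sum_range_add_sum_Ico _ hrN] at hN
    have hsum : ∑ p ∈ (Finset.Ico (r + 1) N).filter (fun p : ℕ ↦ p.Prime ∧ ZMod.χ₈ p ≠ 1),
        (-(p : ℝ)⁻¹) = -∑ p ∈ Finset.Ico (r + 1) N, e p := by
      rw [Finset.sum_neg_distrib, Finset.sum_filter]
      simp only [he, one_div]
    refine lt_of_le_of_lt (Finset.prod_le_prod (fun p hp ↦ ?_) fun p hp ↦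
      (by linarith [Real.add_one_le_exp (-(p : ℝ)⁻¹)] :
        1 - (p : ℝ)⁻¹ ≤ Real.exp (-(p : ℝ)⁻¹))) ?_
    · have : (1 : ℝ) ≤ p := by exact_mod_cast (Finset.mem_filter.1 hp).2.1.one_lt.le
      exact sub_nonneg.2 (inv_le_one_of_one_le₀ this)
    · rw [← Real.exp_sum, hsum, ← Real.exp_log hε]
      exact Real.exp_lt_exp.2 (by linarith)

/-! ### Density bounds -/

theorem upperAsymptoticDensity_le_of_eventually {A : Set ℕ} {a : ℝ}
    (h : ∀ᶠ N : ℕ in Filter.atTop, ((A ∩ Set.Icc 1 N).ncard : ℝ) / N ≤ a) :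
    upperAsymptoticDensity A ≤ a :=
  Filter.limsup_le_of_le (Filter.isCoboundedUnder_le_of_le Filter.atTop (x := 0)
    fun _ ↦ by positivity) h

/-- A set of integers `n` such that `n + 1` or `n + 2` is coprime to `Q` has upper density
at most `2 φ(Q) / Q`. -/
theorem upperAsymptoticDensity_le_totient {A : Set ℕ} {Q : ℕ} (hQ : Q ≠ 0)
    (hA : ∀ n ∈ A, Q.Coprime (n + 1) ∨ Q.Coprime (n + 2)) {δ : ℝ} (hδ : 0 < δ) :
    upperAsymptoticDensity A ≤ 2 * ((Q.totient : ℝ) / Q) + δ := by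
  refine upperAsymptoticDensity_le_of_eventually ?_
  obtain ⟨N₀, hN₀⟩ := exists_nat_gt (2 * (Q.totient : ℝ) / δ)
  filter_upwards [Filter.eventually_ge_atTop (max N₀ 1)] with N hN
  have hN1 : 0 < N := (le_max_right _ _).trans hN
  have hNpos : (0 : ℝ) < N := Nat.cast_pos.2 hN1
  have hcard : (A ∩ Set.Icc 1 N).ncard ≤ 2 * (Q.totient * (N / Q + 1)) := by
    have hsub : A ∩ Set.Icc 1 N ⊆
        (((Finset.Ico 2 (2 + N)).filter Q.Coprime).image (· - 1) ∪
          ((Finset.Ico 3 (3 + N)).filter Q.Coprime).image (· - 2) : Finset ℕ) := by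
      rintro n ⟨hn, hn1, hnN⟩
      simp only [Finset.coe_union, Finset.coe_image, Finset.coe_filter, Finset.mem_Ico]
      rcases hA n hn with h | h
      · exact Or.inl ⟨n + 1, ⟨⟨by omega, by omega⟩, h⟩, by simp⟩
      · exact Or.inr ⟨n + 2, ⟨⟨by omega, by omega⟩, h⟩, by simp⟩
    refine (Set.ncard_le_ncard hsub (Finset.finite_toSet _)).trans ?_
    rw [Set.ncard_coe_finset, two_mul]
    exact (Finset.card_union_le _ _).trans (add_le_add
      (Finset.card_image_le.trans (Nat.Ico_filter_coprime_le _ _ hQ))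
      (Finset.card_image_le.trans (Nat.Ico_filter_coprime_le _ _ hQ)))
  have hcard' : ((A ∩ Set.Icc 1 N).ncard : ℝ) ≤ 2 * (Q.totient * ((N : ℝ) / Q + 1)) := by
    calc ((A ∩ Set.Icc 1 N).ncard : ℝ) ≤ ((2 * (Q.totient * (N / Q + 1)) : ℕ) : ℝ) :=
          Nat.cast_le.2 hcard
      _ ≤ _ := by
          push_cast
          gcongr
          exact Nat.cast_div_le
  have hN₀N : 2 * (Q.totient : ℝ) < N * δ := by
    rw [← div_lt_iff₀ hδ]
    exact hN₀.trans_le (Nat.cast_le.2 ((le_max_left _ _).trans hN))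
  rw [div_le_iff₀ hNpos]
  have : 2 * ((Q.totient : ℝ) * ((N : ℝ) / Q + 1)) =
      2 * ((Q.totient : ℝ) / Q) * N + 2 * Q.totient := by ring
  linarith

/-- For `r > 1` the integers `n` with `binomialSum r n` integral have density zero. -/
theorem upperAsymptoticDensity_binomialSum_int_le_zero {r : ℕ} (hr : 1 < r) :
    upperAsymptoticDensity {n : ℕ | 0 < n ∧ ∃ m : ℤ, binomialSum r n = (m : ℚ)} ≤ 0 := by
  refine le_of_forall_pos_le_add fun ε hε ↦ ?_
  obtain ⟨P, hP, hlt⟩ := exists_prod_one_sub_inv_lt r (by positivity : 0 < ε / 4)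
  set Q := ∏ p ∈ P, p with hQ
  have hQ0 : Q ≠ 0 := Finset.prod_ne_zero_iff.2 fun p hp ↦ (hP p hp).1.ne_zero
  have hcop : ∀ n ∈ {n : ℕ | 0 < n ∧ ∃ m : ℤ, binomialSum r n = (m : ℚ)},
      Q.Coprime (n + 1) ∨ Q.Coprime (n + 2) := by
    rintro n ⟨-, m, hm⟩
    obtain ⟨r, rfl⟩ : ∃ t, r = t + 1 := ⟨r - 1, by omega⟩
    have key : ∀ i ≤ r, Odd (n + i + 1) → Q.Coprime (n + i + 1) := by
      intro i hi hodd
      refine Nat.Coprime.prod_left fun p hp ↦ ?_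
      obtain ⟨h1, h2, h3⟩ := hP p hp
      refine (Nat.Prime.coprime_iff_not_dvd h1).2 fun hd ↦ ?_
      exact binomialSum_not_int h1 h2 (by omega) h3 hi hodd hd m hm
    -- Odd n uses i = 1, which lies in the window because the original r exceeds 1.
    rcases Nat.even_or_odd n with h | h
    · exact Or.inl (key 0 (Nat.zero_le _) h.add_one)
    · exact Or.inr (key 1 (by omega) h.add_one.add_one)
  have htot : (Q.totient : ℝ) / Q = ∏ p ∈ P, (1 - (p : ℝ)⁻¹) := by
    have h := Nat.totient_eq_mul_prod_factors Q
    rw [hQ, Nat.primeFactors_prod fun p hp ↦ (hP p hp).1, ← hQ] at h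
    have h' : (Q.totient : ℝ) = Q * ∏ p ∈ P, (1 - (p : ℝ)⁻¹) := by
      have h2 := congrArg (Rat.cast : ℚ → ℝ) h
      push_cast at h2
      exact h2
    rw [h', mul_div_cancel_left₀ _ (Nat.cast_ne_zero.2 hQ0)]
  have := upperAsymptoticDensity_le_totient hQ0 hcop (by positivity : 0 < ε / 2)
  rw [htot] at this
  linarith

theorem theorem3 (k : ℝ) (hk : 0 < k) :
    ∃ c : ℝ, 0 < c ∧ ∀ r : ℕ, 1 < r →
      upperAsymptoticDensity {n : ℕ | 0 < n ∧ ∃ m : ℤ, binomialSum r n = (m : ℚ)} ≤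
        c / (r : ℝ) ^ k := by
  refine ⟨1, one_pos, fun r hr ↦ ?_⟩
  exact (upperAsymptoticDensity_binomialSum_int_le_zero hr).trans (by positivity)
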